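/- Let $p$ be a prime with $p\equiv 1\pmod 3$, and let $a$ be an element of multiplicative order $3$ in $\mathbb{Z}_p$. Let $\Sigma$ be the graph with vertex set $\mathbb{Z}_p\times\mathbb{Z}_p\times\mathbb{Z}_2$ and edges $$\{(x,y,0),(x+1,y+1,1)\},\quad \{(x,y,0),(x+a,y+a^2,1)\},\quad \{(x,y,0),(x+a^2,y+a,1)\}\qquad (x,y\in\mathbb{Z}_p),$$ which is bipartite with halves $\Delta_\varepsilon=\{(x,y,\varepsilon)\mid x,y\in\mathbb{Z}_p\}$, $\varepsilon\in\mathbb{Z}_2$. Define permutations of the vertex set by $$t_{u,v}:(x,y,\varepsilon)\mapsto(x+u,y+v,\varepsilon),\quad \tau:(x,y,\varepsilon)\mapsto(ax,a^2y,\varepsilon),\quad \sigma:(x,y,\varepsilon)\mapsto(y,x,\varepsilon),\quad \nu:(x,y,\varepsilon)\mapsto(-x,-y,1-\varepsilon),$$ and let $N=\{t_{u,v}\mid u,v\in\mathbb{Z}_p\}\cong\mathbb{Z}_p^2$. Terminology. A transitive permutation group is quasiprimitive if all its nontrivial normal subgroups are transitive; it is biquasiprimitive if it is not quasiprimitive and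 all its nontrivial normal subgroups have at most two orbits. For a permutation group $X$, $X^+$ is the subgroup generated by all point stabilisers in $X$; a group acting on a set is called quasiprimitive on it if the permutation group it induces there is quasiprimitive. An $s$-arc is a tuple $(v_0,\dots,v_s)$ of vertices with $v_{i-1}$ adjacent to $v_i$ for $1\le i\le s$ and $v_{j-1}\ne v_{j+1}$ for $1\le j\le s-1$. For $s\geq 1$, a connected graph is $(X,s)$-arc transitive, where $X$ is a group of automorphisms, if it has $s$-arcs and $X$ is transitive on the set of $i$-arcs for each $1\le i\le s$. Let $G$ be the group generated by $N,\tau,\sigma\nu$, and let $A$ be the group generated by $N,\tau,\sigma,\nu$. Then: 1. $G=N\rtimes\langle\tau,\sigma\nu\rangle\cong\mathbb{Z}_p^2\rtimes S_3$, where $\langle\tau,\sigma\nu\rangle\cong S_3$. The group $G$ is biquasiprimitive on the vertices of $\Sigma$. The orbits of $G^+$ on vertices are the two halves $\Delta_0,\Delta_1$, and $G^+$ is not quasiprimitive on either of them. The graph $\Sigma$ is (connected and) $(G,1)$-arc transitive but not $(G,2)$-arc transitive. 2. The full automorphism group of $\Sigma$ is $A$, and $A=N\rtimes\langle\tau,\sigma,\nu\rangle\cong\mathbb{Z}_p^2\rtimes(S_3\times\mathbb{Z}_2)$,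 where $\langle\tau,\sigma,\nu\rangle\cong S_3\times\mathbb{Z}_2$. The graph $\Sigma$ is $(A,2)$-arc transitive, and $A$ is biquasiprimitive on the vertices of $\Sigma$. The orbits of $A^+$ on vertices are the two halves $\Delta_0,\Delta_1$, and $A^+$ is quasiprimitive on each of them. -/

import Mathlib

open Equiv

/-! ### Permutation groups -/

/-- The permutation group induced on the set `Δ` by the elements of the permutation group `H` that
leave `Δ` invariant (by all of `H` when `Δ` is a union of `H`-orbits). -/
def inducedPermGroup {Ω : Type*} (H : Subgroup (Perm Ω)) (Δ : Set Ω) : Subgroup (Perm Δ) where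
  carrier := {π | ∃ h ∈ H, ∀ x : Δ, h (x : Ω) = (π x : Ω)}
  one_mem' := ⟨1, H.one_mem, fun _ => rfl⟩
  mul_mem' := by
    rintro π ρ ⟨h, hh, hπ⟩ ⟨k, hk, hρ⟩
    exact ⟨h * k, H.mul_mem hh hk, fun x => by rw [Perm.mul_apply, hρ, hπ, Perm.mul_apply]⟩
  inv_mem' := by
    rintro π ⟨h, hh, hπ⟩
    refine ⟨h⁻¹, H.inv_mem hh, fun x => ?_⟩
    rw [Perm.inv_eq_iff_eq, hπ]; simp

/-- `H` is quasiprimitive on `Δ`: the permutation group that `H` induces on `Δ` is transitive, and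
all its nontrivial normal subgroups are transitive. -/
def IsQuasiprimitiveOn {Ω : Type*} (H : Subgroup (Perm Ω)) (Δ : Set Ω) : Prop :=
  MulAction.IsQuasiPreprimitive (inducedPermGroup H Δ) Δ

/-- The transitive permutation group `G` is biquasiprimitive: it is not quasiprimitive, and every
nontrivial normal subgroup has at most two orbits. -/
def IsBiquasiprimitive {Ω : Type*} (G : Subgroup (Perm Ω)) : Prop :=
  MulAction.IsPretransitive G Ω ∧
  ¬ MulAction.IsQuasiPreprimitive G Ω ∧
  ∀ M : Subgroup G, M.Normal → M ≠ ⊥ → ENat.card (MulAction.orbitRel.Quotient M Ω) ≤ 2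

/-- The even subgroup `G⁺`: the subgroup generated by all the point stabilisers `G_v`. -/
def evenSubgroup {Ω : Type*} (G : Subgroup (Perm Ω)) : Subgroup (Perm Ω) :=
  Subgroup.closure {g | g ∈ G ∧ ∃ v : Ω, g v = v}

/-- The group `X` is the internal semidirect product `N ⋊ K`. -/
def IsInternalSemidirectProduct {Γ : Type*} [Group Γ] (X N K : Subgroup Γ) : Prop :=
  N ≤ X ∧ K ≤ X ∧ (N.subgroupOf X).Normal ∧ N ⊓ K = ⊥ ∧ N ⊔ K = X

/-! ### Graphs -/

/-- The automorphism group of a graph, as a permutation group on the vertices. -/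
def graphAut {V : Type*} (Γ : SimpleGraph V) : Subgroup (Perm V) where
  carrier := {π | ∀ v w, Γ.Adj (π v) (π w) ↔ Γ.Adj v w}
  one_mem' := fun _ _ => Iff.rfl
  mul_mem' := by
    intro π ρ hπ hρ v w
    rw [Perm.mul_apply, Perm.mul_apply, hπ, hρ]
  inv_mem' := by
    intro π hπ v w
    rw [← hπ]; simp

/-- An `s`-arc: a tuple `(v_0, …, v_s)` of vertices with consecutive ones adjacent and with
`v_j ≠ v_{j+2}` throughout. -/
def IsSArc {V : Type*} (Γ : SimpleGraph V) (s : ℕ) (v : Fin (s + 1) → V) : Prop :=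
  (∀ i : Fin s, Γ.Adj (v i.castSucc) (v i.succ)) ∧
  ∀ (j : ℕ) (hj : j + 2 < s + 1), v ⟨j, by omega⟩ ≠ v ⟨j + 2, hj⟩

/-- `Γ` is `(G,s)`-arc transitive: `Γ` is connected, `G` is a group of automorphisms of `Γ`, there
are `s`-arcs, and `G` is transitive on the set of `i`-arcs for each `1 ≤ i ≤ s`. -/
def IsArcTransitive {V : Type*} (Γ : SimpleGraph V) (G : Subgroup (Perm V)) (s : ℕ) : Prop :=
  Γ.Connected ∧ G ≤ graphAut Γ ∧ (∃ v, IsSArc Γ s v) ∧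
  ∀ i, 1 ≤ i → i ≤ s → ∀ v w : Fin (i + 1) → V, IsSArc Γ i v → IsSArc Γ i w →
    ∃ g ∈ G, ∀ k, g (v k) = w k

/-! ### The graph `Σ` and its automorphisms -/

namespace SigmaGraph

/-- The vertex set `ℤ_p × ℤ_p × ℤ_2`. -/
abbrev Vertex (p : ℕ) : Type := ZMod p × ZMod p × ZMod 2

/-- `Link a v w`: `v = (x,y,0)` and `w` is one of `(x+1,y+1,1)`, `(x+a,y+a²,1)`,
`(x+a²,y+a,1)`. -/
def Link {p : ℕ} (a : (ZMod p)ˣ) (v w : Vertex p) : Prop :=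
  ∃ x y : ZMod p, v = (x, y, 0) ∧
    (w = (x + 1, y + 1, 1) ∨ w = (x + a, y + a ^ 2, 1) ∨ w = (x + a ^ 2, y + a, 1))

/-- The graph `Σ`. -/
def graph {p : ℕ} (a : (ZMod p)ˣ) : SimpleGraph (Vertex p) where
  Adj v w := Link a v w ∨ Link a w v
  symm := ⟨fun _ _ h => h.symm⟩
  loopless := ⟨by
    rintro v (⟨x, y, rfl, h⟩ | ⟨x, y, rfl, h⟩) <;> simp at h⟩

/-- The bipartite half of the vertices with last coordinate `ε`. -/
def half (p : ℕ) (ε : ZMod 2) : Set (Vertex p) := {v | v.2.2 = ε}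

/-- The translation `t_{u,v} : (x,y,ε) ↦ (x+u,y+v,ε)`. -/
def trans {p : ℕ} (u v : ZMod p) : Perm (Vertex p) where
  toFun z := (z.1 + u, z.2.1 + v, z.2.2)
  invFun z := (z.1 - u, z.2.1 - v, z.2.2)
  left_inv z := by simp
  right_inv z := by simp

/-- The group `N = {t_{u,v}}`. -/
def transGroup (p : ℕ) : Subgroup (Perm (Vertex p)) where
  carrier := {g | ∃ u v : ZMod p, g = trans u v}
  one_mem' := ⟨0, 0, by ext z <;> simp [trans]⟩
  mul_mem' := by
    rintro _ _ ⟨u, v, rfl⟩ ⟨u', v', rfl⟩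
    refine ⟨u' + u, v' + v, Equiv.ext fun z => ?_⟩
    simp [trans, add_assoc]
  inv_mem' := by
    rintro _ ⟨u, v, rfl⟩
    refine ⟨-u, -v, ?_⟩
    rw [inv_eq_iff_mul_eq_one]
    refine Equiv.ext fun z => ?_
    simp [trans]

/-- `τ : (x,y,ε) ↦ (ax,a²y,ε)`. -/
def tau {p : ℕ} (a : (ZMod p)ˣ) : Perm (Vertex p) where
  toFun z := (a * z.1, a ^ 2 * z.2.1, z.2.2)
  invFun z := (a⁻¹.val * z.1, a⁻¹.val ^ 2 * z.2.1, z.2.2)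
  left_inv z := by simp [← mul_assoc, ← mul_pow]
  right_inv z := by simp [← mul_assoc, ← mul_pow]

/-- `σ : (x,y,ε) ↦ (y,x,ε)`. -/
def sigma (p : ℕ) : Perm (Vertex p) where
  toFun z := (z.2.1, z.1, z.2.2)
  invFun z := (z.2.1, z.1, z.2.2)
  left_inv _ := rfl
  right_inv _ := rfl

/-- `ν : (x,y,ε) ↦ (-x,-y,1-ε)`. -/
def nu (p : ℕ) : Perm (Vertex p) where
  toFun z := (-z.1, -z.2.1, 1 - z.2.2)
  invFun z := (-z.1, -z.2.1, 1 - z.2.2)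
  left_inv z := by simp
  right_inv z := by simp

/-- The subgroup `⟨τ, σν⟩`. -/
def complG {p : ℕ} (a : (ZMod p)ˣ) : Subgroup (Perm (Vertex p)) :=
  Subgroup.closure {tau a, sigma p * nu p}

/-- The subgroup `⟨τ, σ, ν⟩`. -/
def complA {p : ℕ} (a : (ZMod p)ˣ) : Subgroup (Perm (Vertex p)) :=
  Subgroup.closure {tau a, sigma p, nu p}

/-- The group `G` generated by `N` and `⟨τ, σν⟩`. -/
def groupG {p : ℕ} (a : (ZMod p)ˣ) : Subgroup (Perm (Vertex p)) := transGroup p ⊔ complG a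

/-- The group `A` generated by `N` and `⟨τ, σ, ν⟩`. -/
def groupA {p : ℕ} (a : (ZMod p)ˣ) : Subgroup (Perm (Vertex p)) := transGroup p ⊔ complA a

end SigmaGraph

namespace SigmaGraph

variable {p : ℕ}

@[simp] lemma trans_apply (u v : ZMod p) (z : Vertex p) :
    trans u v z = (z.1 + u, z.2.1 + v, z.2.2) := rfl

@[simp] lemma tau_apply (a : (ZMod p)ˣ) (z : Vertex p) :
    tau a z = (a * z.1, a ^ 2 * z.2.1, z.2.2) := rfl

@[simp] lemma sigma_apply (z : Vertex p) : sigma p z = (z.2.1, z.1, z.2.2) := rfl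

@[simp] lemma nu_apply (z : Vertex p) : nu p z = (-z.1, -z.2.1, 1 - z.2.2) := rfl

lemma zmod_two_cases (ε : ZMod 2) : ε = 0 ∨ ε = 1 := by
  revert ε; decide

/-! ### Arithmetic of a cube root of unity -/

lemma three_lt_prime [hF : Fact p.Prime] (hp : p ≡ 1 [MOD 3]) : 3 < p := by
  have h := hF.out.two_le
  unfold Nat.ModEq at hp
  by_contra hlt
  interval_cases p <;> simp_all

lemma natCast_ne_zero_of_lt {n : ℕ} (h0 : n ≠ 0) (h : n < p) : (n : ZMod p) ≠ 0 := by
  rw [Ne, ZMod.natCast_eq_zero_iff]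
  exact fun hd => absurd (Nat.le_of_dvd (Nat.pos_of_ne_zero h0) hd) (by omega)

lemma two_ne_zero_zmod (h : 3 < p) : (2 : ZMod p) ≠ 0 := by
  exact_mod_cast natCast_ne_zero_of_lt (n := 2) (by omega) (by omega)

lemma three_ne_zero_zmod (h : 3 < p) : (3 : ZMod p) ≠ 0 := by
  exact_mod_cast natCast_ne_zero_of_lt (n := 3) (by omega) (by omega)

section Root

variable {a : (ZMod p)ˣ} (ha : orderOf a = 3)
include ha

lemma val_pow_three : (a : ZMod p) ^ 3 = 1 := by
  have h := pow_orderOf_eq_one a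
  rw [ha] at h
  simpa using congrArg Units.val h

lemma val_ne_one : (a : ZMod p) ≠ 1 := by
  intro h
  have : a = 1 := Units.ext h
  rw [this, orderOf_one] at ha
  omega

lemma val_quadratic [Fact p.Prime] : (a : ZMod p) ^ 2 + a + 1 = 0 := by
  have h : ((a : ZMod p) - 1) * ((a : ZMod p) ^ 2 + a + 1) = 0 := by
    linear_combination val_pow_three ha
  exact (mul_eq_zero.1 h).resolve_left (sub_ne_zero.2 (val_ne_one ha))

lemma val_pow_eq_one_iff {i : ℕ} (hi : i < 3) : (a : ZMod p) ^ i = 1 ↔ i = 0 := by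
  refine ⟨fun h => ?_, fun h => by simp [h]⟩
  have h' : a ^ i = 1 := Units.ext (by simpa using h)
  have := orderOf_dvd_of_pow_eq_one h'
  rw [ha] at this
  omega

lemma val_pow_ne_neg_one (hp3 : 3 < p) (i : ℕ) : (a : ZMod p) ^ i ≠ -1 := by
  intro h
  have h1 : ((a : ZMod p) ^ i) ^ 3 = 1 := by
    rw [← pow_mul, mul_comm, pow_mul, val_pow_three ha, one_pow]
  rw [h] at h1
  exact two_ne_zero_zmod hp3 (by linear_combination -h1)

end Root

/-! ### The action of `S₃` on the plane -/

/-- The coordinates of a vector of the plane with respect to which `S₃` acts by permutations. -/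
def planeEquiv [Fact p.Prime] (hp3 : 3 < p) {a : (ZMod p)ˣ} (ha : orderOf a = 3) :
    ZMod p × ZMod p ≃ {c : Fin 3 → ZMod p // c 0 + c 1 + c 2 = 0} where
  toFun z := ⟨![z.1 + z.2, a ^ 2 * z.1 + a * z.2, a * z.1 + a ^ 2 * z.2], by
    simp; linear_combination (z.1 + z.2) * val_quadratic ha⟩
  invFun c := (3⁻¹ * (c.1 0 + a * c.1 1 + a ^ 2 * c.1 2),
    3⁻¹ * (c.1 0 + a ^ 2 * c.1 1 + a * c.1 2))
  left_inv z := by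
    have h3 := three_ne_zero_zmod hp3
    have hq := val_pow_three ha
    have hs := val_quadratic ha
    ext
    · simp; field_simp
      linear_combination (2 * z.1 + a * z.2) * hq + z.2 * hs
    · simp; field_simp
      linear_combination (2 * z.2 + a * z.1) * hq + z.1 * hs
  right_inv c := by
    obtain ⟨c, hc⟩ := c
    have h3 := three_ne_zero_zmod hp3
    have hq := val_pow_three ha
    have hs := val_quadratic ha
    ext i
    fin_cases i
    · simp; field_simp
      linear_combination (c 1 + c 2) * hs - hc
    · simp; field_simp
      linear_combination (2 * c 1 + (a : ZMod p) * c 2) * hq + (c 0 + c 2) * hs - hc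
    · simp; field_simp
      linear_combination (2 * c 2 + (a : ZMod p) * c 1) * hq + (c 0 + c 1) * hs - hc

/-- Permutations of the coordinates, as permutations of the plane. -/
def planePerm [Fact p.Prime] (hp3 : 3 < p) {a : (ZMod p)ˣ} (ha : orderOf a = 3) :
    Perm (Fin 3) →* Perm (ZMod p × ZMod p) where
  toFun π := (planeEquiv hp3 ha).trans
    ((Equiv.subtypeEquiv (π.arrowCongr (Equiv.refl (ZMod p))) (fun c => by
      have h : ∀ d : Fin 3 → ZMod p, d 0 + d 1 + d 2 = ∑ i, d i := fun d => by
        rw [Fin.sum_univ_three]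
      rw [h, h]
      have := Equiv.sum_comp π.symm c
      simp only [arrowCongr_apply, Equiv.coe_refl, Function.comp_apply, id]
      rw [this])).trans (planeEquiv hp3 ha).symm)
  map_one' := by
    refine Equiv.ext fun z => ?_
    simp [Equiv.subtypeEquiv]
    exact (planeEquiv hp3 ha).symm_apply_apply z
  map_mul' π ρ := by
    refine Equiv.ext fun z => ?_
    simp [Equiv.subtypeEquiv]
    rfl

/-- `S₃` acting on the vertices, preserving the two halves. -/
def vertexPerm [Fact p.Prime] (hp3 : 3 < p) {a : (ZMod p)ˣ} (ha : orderOf a = 3) :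
    Perm (Fin 3) →* Perm (Vertex p) where
  toFun π := (Equiv.prodAssoc _ _ _).symm.trans
    (((planePerm hp3 ha π).prodCongr (Equiv.refl _)).trans (Equiv.prodAssoc _ _ _))
  map_one' := by ext z <;> simp
  map_mul' π ρ := by ext z <;> simp

lemma perm_fin_three_eq (π : Perm (Fin 3)) :
    ∃ i < 3, ∃ j < 2, π = finRotate 3 ^ i * Equiv.swap 1 2 ^ j := by
  revert π; decide

@[simp] lemma nu_mul_self : nu p * nu p = 1 := by
  refine Equiv.ext fun z => ?_
  simp

lemma tau_commute_nu (a : (ZMod p)ˣ) : Commute (tau a) (nu p) := by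
  ext z <;> simp

lemma sigma_commute_nu : Commute (sigma p) (nu p) := by
  ext z <;> simp

/-- The homomorphism sending the generator of the cyclic group of order two to `ν`. -/
def nuHom (p : ℕ) : Multiplicative (ZMod 2) →* Perm (Vertex p) where
  toFun e := if e = 1 then 1 else nu p
  map_one' := if_pos rfl
  map_mul' e f := by
    have : ∀ e : Multiplicative (ZMod 2), e = 1 ∨ e = Multiplicative.ofAdd 1 := by decide
    have h1 : (Multiplicative.ofAdd 1 : Multiplicative (ZMod 2)) ≠ 1 := by decide
    have h2 : (Multiplicative.ofAdd 1 * Multiplicative.ofAdd 1 : Multiplicative (ZMod 2)) = 1 := by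
      decide
    rcases this e with rfl | rfl <;> rcases this f with rfl | rfl <;>
      simp only [h1, h2, if_true, if_false, mul_one, one_mul, nu_mul_self]

lemma exists_pow_eq_nuHom (e : Multiplicative (ZMod 2)) :
    ∃ k < 2, nuHom p e = nu p ^ k ∧ e = Multiplicative.ofAdd 1 ^ k := by
  have : ∀ e : Multiplicative (ZMod 2), e = 1 ∨ e = Multiplicative.ofAdd 1 := by decide
  rcases this e with rfl | rfl
  · exact ⟨0, by simp, by simp, by simp⟩
  · exact ⟨1, by simp, by simp [nuHom], by simp⟩

lemma nuHom_ofAdd_one : nuHom p (Multiplicative.ofAdd 1) = nu p := by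
  simp [nuHom]

lemma tau_pow_apply (a : (ZMod p)ˣ) (i : ℕ) (z : Vertex p) :
    (tau a ^ i) z = ((a : ZMod p) ^ i * z.1, ((a : ZMod p) ^ i) ^ 2 * z.2.1, z.2.2) := by
  induction i with
  | zero => simp
  | succ n ih =>
    rw [pow_succ', Perm.mul_apply, ih, tau_apply]
    ext <;> simp <;> ring

section Action

variable [Fact p.Prime] (hp3 : 3 < p) {a : (ZMod p)ˣ} (ha : orderOf a = 3)

lemma planePerm_eq_iff (π : Perm (Fin 3)) (z w : ZMod p × ZMod p) :
    planePerm hp3 ha π z = w ↔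
      ∀ i, (planeEquiv hp3 ha w).1 (π i) = (planeEquiv hp3 ha z).1 i := by
  have : planePerm hp3 ha π z = w ↔ _ = planeEquiv hp3 ha w :=
    (Equiv.symm_apply_eq (planeEquiv hp3 ha))
  rw [this, Subtype.ext_iff, funext_iff, ← π.forall_congr_right]
  refine forall_congr' fun i => ?_
  simp [Equiv.subtypeEquiv, eq_comm]

lemma vertexPerm_eq (π : Perm (Fin 3)) (z w : Vertex p) (hε : z.2.2 = w.2.2)
    (h : ∀ i, (planeEquiv hp3 ha (w.1, w.2.1)).1 (π i) =
      (planeEquiv hp3 ha (z.1, z.2.1)).1 i) :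
    vertexPerm hp3 ha π z = w := by
  have h' := (planePerm_eq_iff hp3 ha π _ _).2 h
  simp only [vertexPerm, MonoidHom.coe_mk, OneHom.coe_mk, Equiv.trans_apply,
    Equiv.prodAssoc_symm_apply, Equiv.prodCongr_apply, Prod.map, h', hε]
  rfl

lemma vertexPerm_finRotate : vertexPerm hp3 ha (finRotate 3) = tau a := by
  have hq := val_pow_three ha
  refine Equiv.ext fun z => vertexPerm_eq hp3 ha _ _ _ rfl fun i => ?_
  fin_cases i <;> simp [planeEquiv]
  · linear_combination (z.1 + z.2.1) * hq
  · linear_combination (a * z.2.1) * hq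

lemma vertexPerm_swap : vertexPerm hp3 ha (Equiv.swap 1 2) = sigma p := by
  refine Equiv.ext fun z => vertexPerm_eq hp3 ha _ _ _ rfl fun i => ?_
  fin_cases i <;> simp [planeEquiv, Equiv.swap_apply_def] <;> ring

/-- The action of `S₃ × ℤ₂` on the vertices. -/
def complHom : Perm (Fin 3) × Multiplicative (ZMod 2) →* Perm (Vertex p) :=
  (vertexPerm hp3 ha).noncommCoprod (nuHom p) (by
    intro π e
    obtain ⟨i, -, j, -, rfl⟩ := perm_fin_three_eq π
    obtain ⟨k, -, hk, -⟩ := exists_pow_eq_nuHom (p := p) e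
    rw [hk, map_mul, map_pow, map_pow, vertexPerm_finRotate, vertexPerm_swap]
    exact (((tau_commute_nu a).pow_pow _ _).mul_left (sigma_commute_nu.pow_pow _ _)))

lemma complHom_apply (i j k : ℕ) :
    complHom hp3 ha (finRotate 3 ^ i * Equiv.swap 1 2 ^ j, Multiplicative.ofAdd 1 ^ k) =
      tau a ^ i * sigma p ^ j * nu p ^ k := by
  simp only [complHom, MonoidHom.noncommCoprod_apply, map_mul, map_pow, vertexPerm_finRotate,
    vertexPerm_swap, nuHom_ofAdd_one]

lemma complHom_injective : Function.Injective (complHom hp3 ha) := by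
  rw [injective_iff_map_eq_one]
  rintro ⟨π, e⟩ h
  obtain ⟨i, hi, j, hj, rfl⟩ := perm_fin_three_eq π
  obtain ⟨k, hk, -, rfl⟩ := exists_pow_eq_nuHom (p := p) e
  rw [complHom_apply] at h
  have h1 := DFunLike.congr_fun h ((1, 0, 0) : Vertex p)
  interval_cases j <;> interval_cases k <;> simp [tau_pow_apply] at h1
  rw [val_pow_eq_one_iff ha hi] at h1
  simp [h1]

lemma range_complHom : (complHom hp3 ha).range = complA a := by
  apply le_antisymm
  · rintro _ ⟨⟨π, e⟩, rfl⟩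
    obtain ⟨i, -, j, -, rfl⟩ := perm_fin_three_eq π
    obtain ⟨k, -, -, rfl⟩ := exists_pow_eq_nuHom (p := p) e
    rw [complHom_apply]
    refine mul_mem (mul_mem (pow_mem ?_ _) (pow_mem ?_ _)) (pow_mem ?_ _) <;>
      exact Subgroup.subset_closure (by simp)
  · rw [complA, Subgroup.closure_le]
    rintro g (rfl | rfl | rfl)
    · exact ⟨(finRotate 3 ^ 1 * Equiv.swap 1 2 ^ 0, Multiplicative.ofAdd 1 ^ 0), by
        rw [complHom_apply]; simp⟩
    · exact ⟨(finRotate 3 ^ 0 * Equiv.swap 1 2 ^ 1, Multiplicative.ofAdd 1 ^ 0), by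
        rw [complHom_apply]; simp⟩
    · exact ⟨(finRotate 3 ^ 0 * Equiv.swap 1 2 ^ 0, Multiplicative.ofAdd 1 ^ 1), by
        rw [complHom_apply]; simp⟩

/-- The sign of a permutation, with values in the cyclic group of order two. -/
def signHom : Perm (Fin 3) →* Multiplicative (ZMod 2) where
  toFun π := if Perm.sign π = 1 then 1 else Multiplicative.ofAdd 1
  map_one' := by simp
  map_mul' := by decide

/-- The twisted action of `S₃` on the vertices, in which odd permutations swap the halves. -/
def twistedHom : Perm (Fin 3) →* Perm (Vertex p) :=
  (complHom hp3 ha).comp ((MonoidHom.id _).prod signHom)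

lemma twistedHom_injective : Function.Injective (twistedHom hp3 ha) :=
  (complHom_injective hp3 ha).comp fun _ _ h => (Prod.ext_iff.1 h).1

lemma twistedHom_apply (i j : ℕ) :
    twistedHom hp3 ha (finRotate 3 ^ i * Equiv.swap 1 2 ^ j) =
      tau a ^ i * (sigma p * nu p) ^ j := by
  have h1 : signHom (finRotate 3) = 1 := by decide
  have h2 : signHom (Equiv.swap 1 2) = Multiplicative.ofAdd 1 := by decide
  have h3 : ((MonoidHom.id _).prod signHom) (finRotate 3 ^ i * Equiv.swap 1 2 ^ j) =
      (finRotate 3 ^ i * Equiv.swap 1 2 ^ j, Multiplicative.ofAdd 1 ^ j) := by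
    simp [h1, h2]
  rw [twistedHom, MonoidHom.comp_apply, h3, complHom_apply, sigma_commute_nu.mul_pow, mul_assoc]

lemma range_twistedHom : (twistedHom hp3 ha).range = complG a := by
  apply le_antisymm
  · rintro _ ⟨π, rfl⟩
    obtain ⟨i, -, j, -, rfl⟩ := perm_fin_three_eq π
    rw [twistedHom_apply]
    refine mul_mem (pow_mem ?_ _) (pow_mem ?_ _) <;> exact Subgroup.subset_closure (by simp)
  · rw [complG, Subgroup.closure_le]
    rintro g (rfl | rfl)
    · exact ⟨finRotate 3 ^ 1 * Equiv.swap 1 2 ^ 0, by rw [twistedHom_apply]; simp⟩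
    · exact ⟨finRotate 3 ^ 0 * Equiv.swap 1 2 ^ 1, by rw [twistedHom_apply]; simp⟩

end Action

/-! ### Normal forms -/

lemma trans_mul (u v u' v' : ZMod p) : trans u v * trans u' v' = trans (u + u') (v + v') := by
  refine Equiv.ext fun z => ?_
  simp [add_left_comm, add_comm]

lemma trans_zero : trans (0 : ZMod p) 0 = 1 := by
  refine Equiv.ext fun z => ?_
  simp

lemma trans_inv (u v : ZMod p) : (trans u v)⁻¹ = trans (-u) (-v) := by
  rw [inv_eq_iff_mul_eq_one, trans_mul]
  simp [trans_zero]

lemma trans_mem (u v : ZMod p) : trans u v ∈ transGroup p := ⟨u, v, rfl⟩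

lemma tau_conj_trans (a : (ZMod p)ˣ) (u v : ZMod p) :
    tau a * trans u v * (tau a)⁻¹ = trans ((a : ZMod p) * u) ((a : ZMod p) ^ 2 * v) := by
  rw [mul_inv_eq_iff_eq_mul]
  refine Equiv.ext fun z => ?_
  simp [mul_add]

lemma sigma_conj_trans (u v : ZMod p) : sigma p * trans u v * (sigma p)⁻¹ = trans v u := by
  rw [mul_inv_eq_iff_eq_mul]
  refine Equiv.ext fun z => ?_
  simp

lemma nu_conj_trans (u v : ZMod p) : nu p * trans u v * (nu p)⁻¹ = trans (-u) (-v) := by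
  rw [mul_inv_eq_iff_eq_mul]
  refine Equiv.ext fun z => ?_
  simp [add_comm]

lemma complG_le_complA (a : (ZMod p)ˣ) : complG a ≤ complA a := by
  rw [complG, Subgroup.closure_le]
  rintro g (rfl | rfl)
  · exact Subgroup.subset_closure (by simp)
  · exact mul_mem (Subgroup.subset_closure (by simp)) (Subgroup.subset_closure (by simp))

lemma groupG_le_groupA (a : (ZMod p)ˣ) : groupG a ≤ groupA a :=
  sup_le_sup_left (complG_le_complA a) _

lemma transGroup_le_groupG (a : (ZMod p)ˣ) : transGroup p ≤ groupG a := le_sup_left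

lemma tau_mem_groupG (a : (ZMod p)ˣ) : tau a ∈ groupG a :=
  le_sup_right (a := transGroup p) (Subgroup.subset_closure (by simp) : _ ∈ complG a)

lemma sigma_mul_nu_mem_groupG (a : (ZMod p)ˣ) : sigma p * nu p ∈ groupG a :=
  le_sup_right (a := transGroup p) (Subgroup.subset_closure (by simp) : _ ∈ complG a)

lemma sigma_mem_groupA (a : (ZMod p)ˣ) : sigma p ∈ groupA a :=
  le_sup_right (a := transGroup p) (Subgroup.subset_closure (by simp) : _ ∈ complA a)

lemma nu_mem_groupA (a : (ZMod p)ˣ) : nu p ∈ groupA a :=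
  le_sup_right (a := transGroup p) (Subgroup.subset_closure (by simp) : _ ∈ complA a)

lemma mem_normalizer_of_conj [NeZero p] {g : Perm (Vertex p)}
    (h : ∀ u v, g * trans u v * g⁻¹ ∈ transGroup p) : g ∈ Subgroup.normalizer (transGroup p) := by
  apply Subgroup.mem_normalizer_fintype
  rintro _ ⟨u, v, rfl⟩
  exact h u v

lemma complA_le_normalizer [NeZero p] (a : (ZMod p)ˣ) :
    complA a ≤ Subgroup.normalizer (transGroup p) := by
  rw [complA, Subgroup.closure_le]
  rintro g (rfl | rfl | rfl) <;> refine mem_normalizer_of_conj fun u v => ?_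
  · rw [tau_conj_trans]; exact trans_mem _ _
  · rw [sigma_conj_trans]; exact trans_mem _ _
  · rw [nu_conj_trans]; exact trans_mem _ _

section NormalForm

variable [Fact p.Prime] (hp3 : 3 < p) {a : (ZMod p)ˣ} (ha : orderOf a = 3)
include hp3 ha

lemma exists_eq_of_mem_groupA {g : Perm (Vertex p)} (hg : g ∈ groupA a) :
    ∃ u v : ZMod p, ∃ i < 3, ∃ j < 2, ∃ k < 2,
      g = trans u v * (tau a ^ i * sigma p ^ j * nu p ^ k) := by
  rw [groupA, ← SetLike.mem_coe,
    Subgroup.coe_mul_of_right_le_normalizer_left _ _ (complA_le_normalizer a)] at hg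
  obtain ⟨_, ⟨u, v, rfl⟩, h, hh, rfl⟩ := hg
  rw [SetLike.mem_coe, ← range_complHom hp3 ha] at hh
  obtain ⟨⟨π, e⟩, rfl⟩ := hh
  obtain ⟨i, hi, j, hj, rfl⟩ := perm_fin_three_eq π
  obtain ⟨k, hk, -, rfl⟩ := exists_pow_eq_nuHom (p := p) e
  exact ⟨u, v, i, hi, j, hj, k, hk, by rw [complHom_apply]⟩

lemma exists_eq_of_mem_groupG {g : Perm (Vertex p)} (hg : g ∈ groupG a) :
    ∃ u v : ZMod p, ∃ i < 3, ∃ j < 2, g = trans u v * (tau a ^ i * (sigma p * nu p) ^ j) := by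
  rw [groupG, ← SetLike.mem_coe, Subgroup.coe_mul_of_right_le_normalizer_left _ _
    ((complG_le_complA a).trans (complA_le_normalizer a))] at hg
  obtain ⟨_, ⟨u, v, rfl⟩, h, hh, rfl⟩ := hg
  rw [SetLike.mem_coe, ← range_twistedHom hp3 ha] at hh
  obtain ⟨π, rfl⟩ := hh
  obtain ⟨i, hi, j, hj, rfl⟩ := perm_fin_three_eq π
  exact ⟨u, v, i, hi, j, hj, by rw [twistedHom_apply]⟩

end NormalForm

end SigmaGraph

/-- An internal semidirect product is isomorphic to an external one of groups isomorphic to its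
factors. -/
lemma IsInternalSemidirectProduct.exists_mulEquiv {Γ N' K' : Type*} [Group Γ] [Group N'] [Group K']
    {X N K : Subgroup Γ} (h : IsInternalSemidirectProduct X N K) (eN : N ≃* N') (eK : K ≃* K') :
    ∃ φ : K' →* MulAut N', Nonempty (X ≃* SemidirectProduct N' K' φ) := by
  obtain ⟨hN, hK, hnorm, hinf, hsup⟩ := h
  have hc : (N.subgroupOf X).IsComplement' (K.subgroupOf X) := by
    apply Subgroup.isComplement'_of_disjoint_and_mul_eq_univ
    · rw [disjoint_iff, eq_bot_iff]
      intro x hx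
      have : (x : Γ) ∈ N ⊓ K := ⟨hx.1, hx.2⟩
      rw [hinf] at this
      exact Subtype.ext (Subgroup.mem_bot.1 this)
    · rw [← Subgroup.normal_mul, ← Subgroup.subgroupOf_sup hN hK, hsup, Subgroup.subgroupOf_self,
        Subgroup.coe_top]
  exact ⟨_, ⟨(SemidirectProduct.mulEquivSubgroup hc).symm.trans
    (SemidirectProduct.congr' ((Subgroup.subgroupOfEquivOfLe hN).trans eN)
      ((Subgroup.subgroupOfEquivOfLe hK).trans eK))⟩⟩

namespace SigmaGraph

variable {p : ℕ}

/-- The group of translations is isomorphic to `ℤ_p²`. -/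
def transEquiv (p : ℕ) : transGroup p ≃* Multiplicative (ZMod p × ZMod p) where
  toFun g := Multiplicative.ofAdd ((g.1 (0, 0, 0)).1, (g.1 (0, 0, 0)).2.1)
  invFun w := ⟨trans w.toAdd.1 w.toAdd.2, trans_mem _ _⟩
  left_inv := by
    rintro ⟨_, u, v, rfl⟩
    simp
  right_inv w := by simp
  map_mul' := by
    rintro ⟨_, u, v, rfl⟩ ⟨_, u', v', rfl⟩
    simp [← ofAdd_add, add_comm]

/-- The complements preserve the set of the two vertices over the origin. -/
lemma complA_apply_zero_iff {a : (ZMod p)ˣ} {g : Perm (Vertex p)} (hg : g ∈ complA a) :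
    ∀ z : Vertex p, (g z).1 = 0 ∧ (g z).2.1 = 0 ↔ z.1 = 0 ∧ z.2.1 = 0 := by
  refine Subgroup.closure_induction (p := fun g _ => ∀ z : Vertex p,
    (g z).1 = 0 ∧ (g z).2.1 = 0 ↔ z.1 = 0 ∧ z.2.1 = 0) ?_ ?_ ?_ ?_ hg
  · rintro g (rfl | rfl | rfl) z
    · have h2 : (a : ZMod p) ^ 2 = ((a ^ 2 : (ZMod p)ˣ) : ZMod p) := by simp
      rw [tau_apply, h2, Units.mul_right_eq_zero, Units.mul_right_eq_zero]
    · simp [and_comm]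
    · simp
  · exact fun z => Iff.rfl
  · intro g h _ _ ihg ihh z
    rw [Perm.mul_apply, ihg, ihh]
  · intro g _ ih z
    rw [← ih, ← Perm.mul_apply, mul_inv_cancel, Perm.one_apply]

lemma transGroup_inf_complA (a : (ZMod p)ˣ) : transGroup p ⊓ complA a = ⊥ := by
  rw [eq_bot_iff]
  rintro _ ⟨⟨u, v, rfl⟩, hg⟩
  have h := (complA_apply_zero_iff hg (0, 0, 0)).2 ⟨rfl, rfl⟩
  simp at h
  simp [h, trans_zero]

lemma isInternalSemidirectProduct_of_le_complA [NeZero p] {a : (ZMod p)ˣ}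
    {K : Subgroup (Perm (Vertex p))} (hK : K ≤ complA a) :
    IsInternalSemidirectProduct (transGroup p ⊔ K) (transGroup p) K := by
  refine ⟨le_sup_left, le_sup_right, ?_, ?_, rfl⟩
  · exact Subgroup.normal_subgroupOf_of_le_normalizer
      (sup_le Subgroup.le_normalizer (hK.trans (complA_le_normalizer a)))
  · exact eq_bot_mono (inf_le_inf_left _ hK) (transGroup_inf_complA a)

/-- The isomorphism `⟨τ, σ, ν⟩ ≅ S₃ × ℤ₂`. -/
noncomputable def complAEquiv [Fact p.Prime] (hp3 : 3 < p) {a : (ZMod p)ˣ} (ha : orderOf a = 3) :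
    complA a ≃* Perm (Fin 3) × Multiplicative (ZMod 2) :=
  ((MonoidHom.ofInjective (complHom_injective hp3 ha)).trans
    (MulEquiv.subgroupCongr (range_complHom hp3 ha))).symm

/-- The isomorphism `⟨τ, σν⟩ ≅ S₃`. -/
noncomputable def complGEquiv [Fact p.Prime] (hp3 : 3 < p) {a : (ZMod p)ˣ} (ha : orderOf a = 3) :
    complG a ≃* Perm (Fin 3) :=
  ((MonoidHom.ofInjective (twistedHom_injective hp3 ha)).trans
    (MulEquiv.subgroupCongr (range_twistedHom hp3 ha))).symm


/-! ### Neighbours -/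

/-- The sign attached to a half. -/
def halfSign (p : ℕ) (ε : ZMod 2) : ZMod p := if ε = 0 then 1 else -1

lemma halfSign_one_sub (ε : ZMod 2) : halfSign p (1 - ε) = -halfSign p ε := by
  rcases zmod_two_cases ε with rfl | rfl <;> simp [halfSign]

lemma halfSign_mul_self (ε : ZMod 2) : halfSign p ε * halfSign p ε = 1 := by
  rcases zmod_two_cases ε with rfl | rfl <;> simp [halfSign]

/-- The neighbour of the vertex `z` in the direction `i`. -/
def nbr (a : (ZMod p)ˣ) (i : Fin 3) (z : Vertex p) : Vertex p :=
  (z.1 + halfSign p z.2.2 * (a : ZMod p) ^ (i : ℕ),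
    z.2.1 + halfSign p z.2.2 * ((a : ZMod p) ^ (i : ℕ)) ^ 2, 1 - z.2.2)

lemma nbr_nbr (a : (ZMod p)ˣ) (i j : Fin 3) (z : Vertex p) :
    nbr a j (nbr a i z) =
      (z.1 + halfSign p z.2.2 * ((a : ZMod p) ^ (i : ℕ) - (a : ZMod p) ^ (j : ℕ)),
        z.2.1 + halfSign p z.2.2 * (((a : ZMod p) ^ (i : ℕ)) ^ 2 - ((a : ZMod p) ^ (j : ℕ)) ^ 2),
        z.2.2) := by
  simp only [nbr, halfSign_one_sub, sub_sub_cancel, Prod.mk.injEq, and_true]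
  constructor <;> ring

@[simp] lemma nbr_nbr_self (a : (ZMod p)ˣ) (i : Fin 3) (z : Vertex p) :
    nbr a i (nbr a i z) = z := by
  simp [nbr_nbr]

section Root

variable [Fact p.Prime] {a : (ZMod p)ˣ} (ha : orderOf a = 3)
include ha

lemma adj_iff {v w : Vertex p} : (graph a).Adj v w ↔ ∃ i, w = nbr a i v := by
  have h4 : ((a : ZMod p) ^ 2) ^ 2 = a := by linear_combination (a : ZMod p) * val_pow_three ha
  constructor
  · rintro (⟨x, y, rfl, rfl | rfl | rfl⟩ | ⟨x, y, rfl, rfl | rfl | rfl⟩)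
    · exact ⟨0, by simp [nbr, halfSign]⟩
    · exact ⟨1, by simp [nbr, halfSign]⟩
    · exact ⟨2, by simp [nbr, halfSign, h4]⟩
    · exact ⟨0, by simp [nbr, halfSign]⟩
    · exact ⟨1, by simp [nbr, halfSign]⟩
    · exact ⟨2, by simp [nbr, halfSign, h4]⟩
  · rintro ⟨i, rfl⟩
    obtain ⟨x, y, ε⟩ := v
    rcases zmod_two_cases ε with rfl | rfl
    · left
      refine ⟨x, y, rfl, ?_⟩
      fin_cases i <;> simp [nbr, halfSign, h4]
    · right
      fin_cases i
      · exact ⟨x - 1, y - 1, by simp [nbr, halfSign, sub_eq_add_neg], by simp⟩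
      · exact ⟨x - a, y - a ^ 2, by simp [nbr, halfSign, sub_eq_add_neg], by simp⟩
      · exact ⟨x - a ^ 2, y - a, by simp [nbr, halfSign, h4, sub_eq_add_neg], by simp⟩

lemma adj_nbr (i : Fin 3) (z : Vertex p) : (graph a).Adj z (nbr a i z) :=
  (adj_iff ha).2 ⟨i, rfl⟩

lemma nbr_injective (z : Vertex p) : Function.Injective fun i => nbr a i z := by
  intro i j h
  have h1 : z.1 + halfSign p z.2.2 * (a : ZMod p) ^ (i : ℕ) =
    z.1 + halfSign p z.2.2 * (a : ZMod p) ^ (j : ℕ) := congrArg Prod.fst h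
  have h2 : (a : ZMod p) ^ (i : ℕ) = (a : ZMod p) ^ (j : ℕ) := by
    linear_combination halfSign p z.2.2 * h1 - ((a : ZMod p) ^ (i : ℕ) - (a : ZMod p) ^ (j : ℕ)) *
      halfSign_mul_self (p := p) z.2.2
  have h3 : a ^ (i : ℕ) = a ^ (j : ℕ) := Units.ext (by simpa using h2)
  exact Fin.ext (pow_injOn_Iio_orderOf (x := a) (by simp [ha]) (by simp [ha]) h3)

/-- The linear form that singles out the direction `k`. -/
lemma direction_form (i k : Fin 3) :
    ((a : ZMod p) ^ (k : ℕ)) ^ 2 * (a : ZMod p) ^ (i : ℕ) +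
      (a : ZMod p) ^ (k : ℕ) * ((a : ZMod p) ^ (i : ℕ)) ^ 2 = if i = k then 2 else -1 := by
  have hs := val_quadratic ha
  have hq := val_pow_three ha
  generalize (a : ZMod p) = b at *
  fin_cases i <;> fin_cases k <;> simp <;> grind

end Root

/-! ### Automorphisms permuting the directions -/

/-- The permutation `g` maps the neighbour in direction `i` to that in direction `π i`. -/
def PermutesDirections (a : (ZMod p)ˣ) (g : Perm (Vertex p)) (π : Perm (Fin 3)) : Prop :=
  ∀ i z, g (nbr a i z) = nbr a (π i) (g z)

lemma PermutesDirections.one (a : (ZMod p)ˣ) : PermutesDirections a 1 1 := fun _ _ => rfl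

lemma PermutesDirections.mul {a : (ZMod p)ˣ} {g h : Perm (Vertex p)} {π ρ : Perm (Fin 3)}
    (hg : PermutesDirections a g π) (hh : PermutesDirections a h ρ) :
    PermutesDirections a (g * h) (π * ρ) := fun i z => by
  rw [Perm.mul_apply, hh, hg]; rfl

lemma PermutesDirections.pow {a : (ZMod p)ˣ} {g : Perm (Vertex p)} {π : Perm (Fin 3)}
    (hg : PermutesDirections a g π) (n : ℕ) : PermutesDirections a (g ^ n) (π ^ n) := by
  induction n with
  | zero => exact .one a
  | succ n ih => rw [pow_succ, pow_succ]; exact ih.mul hg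

lemma permutesDirections_trans (a : (ZMod p)ˣ) (u v : ZMod p) :
    PermutesDirections a (trans u v) 1 := fun i z => by
  simp [nbr, add_right_comm]

lemma permutesDirections_nu (a : (ZMod p)ˣ) : PermutesDirections a (nu p) 1 := fun i z => by
  simp [nbr, halfSign_one_sub, add_comm]

section Root

variable [Fact p.Prime] {a : (ZMod p)ˣ} (ha : orderOf a = 3)
include ha

lemma permutesDirections_tau : PermutesDirections a (tau a) (finRotate 3) := fun i z => by
  have hq := val_pow_three ha
  obtain ⟨x, y, ε⟩ := z
  generalize hb : (a : ZMod p) = b at *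
  fin_cases i <;> simp [nbr, mul_add, hb] <;> grind

lemma permutesDirections_sigma : PermutesDirections a (sigma p) (Equiv.swap 1 2) := fun i z => by
  have hq := val_pow_three ha
  obtain ⟨x, y, ε⟩ := z
  generalize hb : (a : ZMod p) = b at *
  fin_cases i <;> simp [nbr, hb, Equiv.swap_apply_def] <;> grind

lemma PermutesDirections.mem_graphAut {g : Perm (Vertex p)} {π : Perm (Fin 3)}
    (hg : PermutesDirections a g π) : g ∈ graphAut (graph a) := by
  intro v w
  rw [adj_iff ha, adj_iff ha, ← π.exists_congr_right]
  refine exists_congr fun i => ?_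
  rw [← hg, g.injective.eq_iff]

lemma groupA_le_graphAut (hp3 : 3 < p) : groupA a ≤ graphAut (graph a) := by
  intro g hg
  obtain ⟨u, v, i, -, j, -, k, -, rfl⟩ := exists_eq_of_mem_groupA hp3 ha hg
  exact ((permutesDirections_trans a u v).mul ((((permutesDirections_tau ha).pow i).mul
    ((permutesDirections_sigma ha).pow j)).mul ((permutesDirections_nu a).pow k))).mem_graphAut ha

/-! ### Connectedness -/

omit ha in
lemma reachable_trans_nsmul {u v : ZMod p}
    (h : ∀ z, (graph a).Reachable z (trans u v z)) (n : ℕ) (z : Vertex p) :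
    (graph a).Reachable z (trans ((n : ZMod p) * u) ((n : ZMod p) * v) z) := by
  induction n with
  | zero => simp
  | succ n ih =>
    refine ih.trans ?_
    convert h (trans ((n : ZMod p) * u) ((n : ZMod p) * v) z) using 1
    simp; constructor <;> ring

omit ha in
lemma reachable_trans_mul {u v : ZMod p}
    (h : ∀ z, (graph a).Reachable z (trans u v z)) (c : ZMod p) (z : Vertex p) :
    (graph a).Reachable z (trans (c * u) (c * v) z) := by
  simpa using reachable_trans_nsmul h c.val z

lemma reachable_trans_sub (i j : Fin 3) (z : Vertex p) :
    (graph a).Reachable z (trans ((a : ZMod p) ^ (i : ℕ) - (a : ZMod p) ^ (j : ℕ))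
      (((a : ZMod p) ^ (i : ℕ)) ^ 2 - ((a : ZMod p) ^ (j : ℕ)) ^ 2) z) := by
  have key : ∀ i j, (graph a).Reachable z (nbr a j (nbr a i z)) := fun i j =>
    (adj_nbr ha i z).reachable.trans (adj_nbr ha j _).reachable
  rcases zmod_two_cases z.2.2 with h | h
  · convert key i j using 1
    simp [nbr_nbr, h, halfSign]
  · convert key j i using 1
    simp [nbr_nbr, h, halfSign]

lemma reachable_trans (hp3 : 3 < p) (x y : ZMod p) (z : Vertex p) :
    (graph a).Reachable z (trans x y z) := by
  have h3 := three_ne_zero_zmod hp3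
  have hs := val_quadratic ha
  have hq := val_pow_three ha
  have h1 := reachable_trans_mul (reachable_trans_sub ha 1 0)
    (3⁻¹ * ((a : ZMod p) ^ 2 * x + a * y)) z
  refine h1.trans ?_
  convert reachable_trans_mul (reachable_trans_sub ha 2 0)
    (3⁻¹ * ((a : ZMod p) * x + (a : ZMod p) ^ 2 * y)) _ using 1
  generalize (a : ZMod p) = b at *
  simp
  constructor <;> field_simp <;> grind

lemma graph_connected (hp3 : 3 < p) : (graph a).Connected := by
  have key : ∀ v w : Vertex p, v.2.2 = w.2.2 → (graph a).Reachable v w := by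
    rintro ⟨x, y, ε⟩ ⟨x', y', ε'⟩ h
    convert reachable_trans ha hp3 (x' - x) (y' - y) (x, y, ε) using 1
    simpa using h.symm
  have : (graph a).Preconnected := by
    intro v w
    by_cases h : v.2.2 = w.2.2
    · exact key v w h
    · refine (adj_nbr ha 0 v).reachable.trans (key _ _ ?_)
      have : ∀ ε δ : ZMod 2, ε ≠ δ → 1 - ε = δ := by decide
      exact this _ _ h
  exact ⟨this⟩

/-! ### Rigidity -/

lemma directions_independent (hp3 : 3 < p) {i k l m n : Fin 3} (hik : i ≠ k) (hmk : m ≠ k)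
    (h1 : (a : ZMod p) ^ (i : ℕ) + (a : ZMod p) ^ (m : ℕ) + (a : ZMod p) ^ (n : ℕ) =
      2 * (a : ZMod p) ^ (k : ℕ) + (a : ZMod p) ^ (l : ℕ))
    (h2 : ((a : ZMod p) ^ (i : ℕ)) ^ 2 + ((a : ZMod p) ^ (m : ℕ)) ^ 2 +
      ((a : ZMod p) ^ (n : ℕ)) ^ 2 =
      2 * ((a : ZMod p) ^ (k : ℕ)) ^ 2 + ((a : ZMod p) ^ (l : ℕ)) ^ 2) : False := by
  have h3 := three_ne_zero_zmod hp3
  have h2' := two_ne_zero_zmod hp3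
  have e1 := direction_form ha i k
  have e2 := direction_form ha m k
  have e3 := direction_form ha n k
  have e4 := direction_form ha k k
  have e5 := direction_form ha l k
  rw [if_neg hik] at e1
  rw [if_neg hmk] at e2
  rw [if_pos rfl] at e4
  have key : (-1 : ZMod p) + -1 + (if n = k then 2 else -1) = 2 * 2 + if l = k then 2 else -1 := by
    linear_combination ((a : ZMod p) ^ (k : ℕ)) ^ 2 * h1 + (a : ZMod p) ^ (k : ℕ) * h2
      - e1 - e2 - e3 + 2 * e4 + e5
  have h6 : (3 : ZMod p) * 2 ≠ 0 := mul_ne_zero h3 h2'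
  have h9 : (3 : ZMod p) * 3 ≠ 0 := mul_ne_zero h3 h3
  split_ifs at key
  · exact h6 (by linear_combination -key)
  · exact h3 (by linear_combination -key)
  · exact h9 (by linear_combination -key)
  · exact h6 (by linear_combination -key)

/-- The hexagon through two adjacent edges is unique, so an automorphism that fixes a vertex and
its neighbours fixes the neighbours of the neighbours. -/
lemma fixes_nbr_nbr (hp3 : 3 < p) {f : Perm (Vertex p)} (hf : f ∈ graphAut (graph a))
    {v : Vertex p} (hv : f v = v) (hn : ∀ i, f (nbr a i v) = nbr a i v) (i j : Fin 3) :
    f (nbr a j (nbr a i v)) = nbr a j (nbr a i v) := by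
  have hmap : ∀ i z, ∃ j, f (nbr a i z) = nbr a j (f z) := fun i z =>
    (adj_iff ha).1 ((hf _ _).2 (adj_nbr ha i z))
  have hback : ∀ i j m : Fin 3, f (nbr a j (nbr a i v)) = nbr a m (nbr a i v) → m = i → j = i := by
    rintro i j m h rfl
    rw [nbr_nbr_self] at h
    have h' : nbr a j (nbr a m v) = nbr a m (nbr a m v) := by
      rw [nbr_nbr_self]; exact f.injective (h.trans hv.symm)
    exact nbr_injective ha _ h'
  obtain ⟨k, hk⟩ := hmap j (nbr a i v)
  rw [hn] at hk
  rcases eq_or_ne k j with rfl | hkj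
  · exact hk
  rcases eq_or_ne j i with rfl | hji
  · rw [nbr_nbr_self, hv]
  have hki : k ≠ i := fun h => hji (hback i j k hk h)
  obtain ⟨m, hm⟩ := hmap j (nbr a k v)
  rw [hn] at hm
  have hmk : m ≠ k := fun h => hkj (hback k j m hm h).symm
  obtain ⟨n, hn'⟩ := hmap k (nbr a j (nbr a i v))
  obtain ⟨l, hl⟩ := hmap i (nbr a j (nbr a k v))
  have hex : nbr a k (nbr a j (nbr a i v)) = nbr a i (nbr a j (nbr a k v)) := by
    simp only [nbr_nbr a j]
    simp only [nbr, halfSign_one_sub, Prod.mk.injEq, and_true]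
    constructor <;> ring
  rw [hex, hl, hm, hk] at hn'
  exfalso
  have hg := halfSign_mul_self (p := p) v.2.2
  simp only [nbr, halfSign_one_sub, sub_sub_cancel, Prod.mk.injEq, and_true] at hn'
  obtain ⟨q1, q2⟩ := hn'
  refine directions_independent ha hp3 (i := i) (k := k) (l := l) (m := m) (n := n)
    hki.symm hmk ?_ ?_
  · generalize halfSign p v.2.2 = s at *
    linear_combination -s * q1 - ((a : ZMod p) ^ (i : ℕ) + (a : ZMod p) ^ (m : ℕ) +
      (a : ZMod p) ^ (n : ℕ) - 2 * (a : ZMod p) ^ (k : ℕ) - (a : ZMod p) ^ (l : ℕ)) * hg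
  · generalize halfSign p v.2.2 = s at *
    linear_combination -s * q2 - (((a : ZMod p) ^ (i : ℕ)) ^ 2 + ((a : ZMod p) ^ (m : ℕ)) ^ 2 +
      ((a : ZMod p) ^ (n : ℕ)) ^ 2 - 2 * ((a : ZMod p) ^ (k : ℕ)) ^ 2 -
      ((a : ZMod p) ^ (l : ℕ)) ^ 2) * hg

lemma eq_one_of_fixes_nbrs (hp3 : 3 < p) {f : Perm (Vertex p)} (hf : f ∈ graphAut (graph a))
    {v : Vertex p} (hv : f v = v) (hn : ∀ i, f (nbr a i v) = nbr a i v) : f = 1 := by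
  refine Equiv.ext fun w => ?_
  obtain ⟨q⟩ := (graph_connected ha hp3).preconnected v w
  induction q with
  | nil => exact hv
  | cons hadj _ ih =>
    obtain ⟨i, rfl⟩ := (adj_iff ha).1 hadj
    exact ih (hn i) fun j => fixes_nbr_nbr ha hp3 hf hv hn i j

/-! ### Transitivity -/

omit ha in
lemma exists_trans_mul_nu (v w : Vertex p) :
    ∃ x y : ZMod p, ∃ k : ℕ, (trans x y * nu p ^ k) v = w := by
  obtain ⟨x, y, ε⟩ := v
  obtain ⟨x', y', ε'⟩ := w
  by_cases h : ε = ε'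
  · exact ⟨x' - x, y' - y, 0, by simp [h]⟩
  · have : ∀ ε δ : ZMod 2, ε ≠ δ → 1 - ε = δ := by decide
    exact ⟨x' + x, y' + y, 1, by simp [this _ _ h, add_comm]⟩

/-- The group `A` is transitive on the vertices with a labelling of the neighbours. -/
lemma exists_mem_groupA_map (π : Perm (Fin 3)) (v w : Vertex p) :
    ∃ g ∈ groupA a, g v = w ∧ ∀ i, g (nbr a i v) = nbr a (π i) w := by
  obtain ⟨i, -, j, -, rfl⟩ := perm_fin_three_eq π
  obtain ⟨x, y, k, h⟩ := exists_trans_mul_nu ((tau a ^ i * sigma p ^ j) v) w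
  refine ⟨(trans x y * nu p ^ k) * (tau a ^ i * sigma p ^ j), ?_, h, fun m => ?_⟩
  · have h1 : trans x y ∈ groupA a := groupG_le_groupA a (transGroup_le_groupG a (trans_mem x y))
    have h2 := groupG_le_groupA a (tau_mem_groupG a)
    exact mul_mem (mul_mem h1 (pow_mem (nu_mem_groupA a) _))
      (mul_mem (pow_mem h2 _) (pow_mem (sigma_mem_groupA a) _))
  · have := (((permutesDirections_trans a x y).mul ((permutesDirections_nu a).pow k)).mul
      (((permutesDirections_tau ha).pow i).mul ((permutesDirections_sigma ha).pow j))) m v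
    refine this.trans ((congrArg _ h).trans ?_)
    simp

lemma graphAut_eq_groupA (hp3 : 3 < p) : graphAut (graph a) = groupA a := by
  refine le_antisymm (fun f hf => ?_) (groupA_le_graphAut ha hp3)
  have hmap : ∀ i, ∃ j, f (nbr a i (0, 0, 0)) = nbr a j (f (0, 0, 0)) := fun i =>
    (adj_iff ha).1 ((hf _ _).2 (adj_nbr ha i _))
  choose π hπ using hmap
  have hinj : Function.Injective π := fun i j hij => by
    apply nbr_injective ha (0, 0, 0)
    apply f.injective
    simp only [hπ, hij]
  obtain ⟨g, hg, h0, h1⟩ := exists_mem_groupA_map ha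
    (Equiv.ofBijective π (Finite.injective_iff_bijective.1 hinj)) (0, 0, 0) (f (0, 0, 0))
  have h : g⁻¹ * f = 1 := by
    refine eq_one_of_fixes_nbrs ha hp3
      (mul_mem (inv_mem (groupA_le_graphAut ha hp3 hg)) hf) (v := (0, 0, 0)) ?_ fun i => ?_
    · rw [Perm.mul_apply, Perm.inv_eq_iff_eq, h0]
    · rw [Perm.mul_apply, Perm.inv_eq_iff_eq, h1, hπ]; rfl
  rw [inv_mul_eq_one] at h
  exact h ▸ hg

/-- The group `G` is transitive on arcs. -/
lemma exists_mem_groupG_map (v w : Vertex p) (i j : Fin 3) :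
    ∃ g ∈ groupG a, g v = w ∧ g (nbr a i v) = nbr a j w := by
  have hσν := (permutesDirections_sigma ha).mul (permutesDirections_nu a)
  have key : ∀ v w : Vertex p, ∃ g ∈ groupG a, g v = w ∧
      ∃ k, PermutesDirections a g (Equiv.swap 1 2 ^ k) := by
    rintro ⟨x, y, ε⟩ ⟨x', y', ε'⟩
    by_cases h : ε = ε'
    · exact ⟨trans (x' - x) (y' - y), transGroup_le_groupG a (trans_mem _ _), by simp [h], 0,
        permutesDirections_trans a _ _⟩
    · have : ∀ ε δ : ZMod 2, ε ≠ δ → 1 - ε = δ := by decide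
      exact ⟨trans (x' + y) (y' + x) * (sigma p * nu p),
        mul_mem (transGroup_le_groupG a (trans_mem _ _)) (sigma_mul_nu_mem_groupG a),
        by simp [this _ _ h, add_comm], 1, by
          simpa using (permutesDirections_trans a (x' + y) (y' + x)).mul hσν⟩
  obtain ⟨g, hg, hgv, k, hk⟩ := key v w
  have hrot : ∀ i j : Fin 3, ∃ m < 3, (finRotate 3 ^ m) i = j := by decide
  obtain ⟨m, -, hm⟩ := hrot ((Equiv.swap 1 2 ^ k : Perm (Fin 3)) i) j
  have hh : PermutesDirections a (trans w.1 w.2.1 * tau a ^ m * trans (-w.1) (-w.2.1))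
      (1 * finRotate 3 ^ m * 1) :=
    ((permutesDirections_trans a _ _).mul ((permutesDirections_tau ha).pow m)).mul
      (permutesDirections_trans a _ _)
  have hw : (trans w.1 w.2.1 * tau a ^ m * trans (-w.1) (-w.2.1)) w = w := by
    simp [tau_pow_apply]
  refine ⟨trans w.1 w.2.1 * tau a ^ m * trans (-w.1) (-w.2.1) * g, ?_, ?_, ?_⟩
  · exact mul_mem (mul_mem (mul_mem (transGroup_le_groupG a (trans_mem _ _))
      (pow_mem (tau_mem_groupG a) _)) (transGroup_le_groupG a (trans_mem _ _))) hg
  · rw [Perm.mul_apply, hgv, hw]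
  · rw [hh.mul hk, Perm.mul_apply _ g, hgv, hw, ← hm]
    simp

/-! ### Arc-transitivity -/

lemma isArcTransitive_groupG_one (hp3 : 3 < p) : IsArcTransitive (graph a) (groupG a) 1 := by
  refine ⟨graph_connected ha hp3, (groupG_le_groupA a).trans (groupA_le_graphAut ha hp3),
    ⟨![(0, 0, 0), nbr a 0 (0, 0, 0)], ?_, fun j hj => by omega⟩, ?_⟩
  · intro i
    fin_cases i
    exact adj_nbr ha _ _
  · intro i h1 h2 v w hv hw
    obtain rfl : i = 1 := le_antisymm h2 h1
    obtain ⟨j, hj⟩ := (adj_iff ha).1 (hv.1 0)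
    obtain ⟨k, hk⟩ := (adj_iff ha).1 (hw.1 0)
    obtain ⟨g, hg, h0, h1⟩ := exists_mem_groupG_map ha (v 0) (w 0) j k
    refine ⟨g, hg, fun m => ?_⟩
    fin_cases m
    · exact h0
    · exact (congrArg g hj).trans (h1.trans hk.symm)

lemma isSArc_two {i j : Fin 3} (hij : i ≠ j) (v : Vertex p) :
    IsSArc (graph a) 2 ![nbr a i v, v, nbr a j v] := by
  refine ⟨fun k => ?_, fun k hk => ?_⟩
  · fin_cases k
    · exact (adj_nbr ha _ _).symm
    · exact adj_nbr ha _ _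
  · obtain rfl : k = 0 := by omega
    exact fun h => hij (nbr_injective ha v h)

lemma isArcTransitive_groupA_two (hp3 : 3 < p) : IsArcTransitive (graph a) (groupA a) 2 := by
  refine ⟨graph_connected ha hp3, groupA_le_graphAut ha hp3,
    ⟨_, isSArc_two ha (i := 0) (j := 1) (by decide) (0, 0, 0)⟩, ?_⟩
  intro i h1 h2 v w hv hw
  obtain rfl | rfl : i = 1 ∨ i = 2 := by omega
  · obtain ⟨g, hg, h⟩ := (isArcTransitive_groupG_one ha hp3).2.2.2 1 le_rfl le_rfl v w hv hw
    exact ⟨g, groupG_le_groupA a hg, h⟩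
  · obtain ⟨j, hj⟩ := (adj_iff ha).1 (hv.1 0).symm
    obtain ⟨k, hk⟩ := (adj_iff ha).1 (hv.1 1)
    obtain ⟨j', hj'⟩ := (adj_iff ha).1 (hw.1 0).symm
    obtain ⟨k', hk'⟩ := (adj_iff ha).1 (hw.1 1)
    have hjk : j ≠ k := fun h => hv.2 0 (by omega) (hj.trans ((congrArg (nbr a · (v 1)) h).trans hk.symm))
    have hjk' : j' ≠ k' := fun h => hw.2 0 (by omega) (hj'.trans ((congrArg (nbr a · (w 1)) h).trans hk'.symm))
    have hπ : ∀ j k j' k' : Fin 3, j ≠ k → j' ≠ k' → ∃ π : Perm (Fin 3), π j = j' ∧ π k = k' := by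
      decide
    obtain ⟨π, rfl, rfl⟩ := hπ j k j' k' hjk hjk'
    obtain ⟨g, hg, h0, h1⟩ := exists_mem_groupA_map ha π (v 1) (w 1)
    refine ⟨g, hg, fun m => ?_⟩
    fin_cases m
    · exact (congrArg g hj).trans ((h1 j).trans hj'.symm)
    · exact h0
    · exact (congrArg g hk).trans ((h1 k).trans hk'.symm)

lemma not_isArcTransitive_groupG_two (hp3 : 3 < p) :
    ¬ IsArcTransitive (graph a) (groupG a) 2 := by
  rintro ⟨-, -, -, h⟩
  obtain ⟨g, hg, hgv⟩ := h 2 (by omega) le_rfl _ _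
    (isSArc_two ha (i := 0) (j := 1) (by decide) (0, 0, 0))
    (isSArc_two ha (i := 0) (j := 2) (by decide) (0, 0, 0))
  have h0 : g (0, 0, 0) = (0, 0, 0) := hgv 1
  have h1 : g (nbr a 0 (0, 0, 0)) = nbr a 0 (0, 0, 0) := hgv 0
  have h2 : g (nbr a 1 (0, 0, 0)) = nbr a 2 (0, 0, 0) := hgv 2
  obtain ⟨u, v, i, hi, j, hj, rfl⟩ := exists_eq_of_mem_groupG hp3 ha hg
  interval_cases j
  · simp [tau_pow_apply] at h0
    simp [tau_pow_apply, h0, nbr, halfSign, val_pow_eq_one_iff ha hi] at h1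
    simp [h1, h0, trans_zero] at h2
    exact absurd (nbr_injective ha _ h2) (by decide)
  · simp [tau_pow_apply] at h0

end Root

end SigmaGraph

/-! ### Induced permutation groups -/

section Induced

variable {Ω : Type*} {H L : Subgroup (Perm Ω)} {Δ : Set Ω}

/-- The restriction of a permutation group to an invariant set. -/
def inducedHom (H : Subgroup (Perm Ω)) (Δ : Set Ω) (hΔ : ∀ h ∈ H, ∀ x, h x ∈ Δ ↔ x ∈ Δ) :
    H →* inducedPermGroup H Δ where
  toFun h := ⟨(h : Perm Ω).subtypePerm (hΔ h h.2), h, h.2, fun _ => rfl⟩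
  map_one' := rfl
  map_mul' _ _ := rfl

lemma inducedHom_surjective (hΔ : ∀ h ∈ H, ∀ x, h x ∈ Δ ↔ x ∈ Δ) :
    Function.Surjective (inducedHom H Δ hΔ) := by
  rintro ⟨π, h, hh, hπ⟩
  exact ⟨⟨h, hh⟩, Subtype.ext (Equiv.ext fun x => Subtype.ext (hπ x))⟩

lemma normal_inducedPermGroup_subgroupOf (hL : ∀ h ∈ H, ∀ l ∈ L, h * l * h⁻¹ ∈ L) :
    ((inducedPermGroup L Δ).subgroupOf (inducedPermGroup H Δ)).Normal := by
  refine ⟨?_⟩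
  rintro ⟨π, hπ'⟩ ⟨l, hl, hlπ⟩ ⟨ρ, h, hh, hρ⟩
  refine ⟨h * l * h⁻¹, hL h hh l hl, fun x => ?_⟩
  have h1 : h⁻¹ (x : Ω) = (ρ⁻¹ x : Δ) := by
    rw [Perm.inv_eq_iff_eq, hρ]
    simp
  rw [Perm.mul_apply, Perm.mul_apply, h1, hlπ, hρ]
  rfl

end Induced

lemma fixedPoints_bot_eq_univ (G X : Type*) [Group G] [MulAction G X] :
    MulAction.fixedPoints (⊥ : Subgroup G) X = Set.univ := by
  refine Set.eq_univ_of_forall fun x => ?_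
  rintro ⟨g, hg⟩
  rw [Subgroup.mem_bot] at hg
  subst hg
  exact one_smul G x

lemma evenSubgroup_le {Ω : Type*} (X : Subgroup (Perm (Ω))) : evenSubgroup X ≤ X :=
  (Subgroup.closure_le _).2 fun _ h => h.1

namespace SigmaGraph

variable {p : ℕ}

/-! ### Normal subgroups contain the translations -/

lemma trans_sub_mem {M : Subgroup (Perm (Vertex p))} {m : Perm (Vertex p)} (hm : m ∈ M)
    (hN : ∀ t ∈ transGroup p, ∀ m ∈ M, t * m * t⁻¹ ∈ M) {x y x' y' : ZMod p}
    (h : m * trans x y = trans x' y' * m) : trans (x' - x) (y' - y) ∈ M := by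
  have h1 : m * (trans x y * m⁻¹ * (trans x y)⁻¹) ∈ M :=
    mul_mem hm (hN _ (trans_mem x y) _ (inv_mem hm))
  convert h1 using 1
  rw [← mul_assoc, ← mul_assoc, h, mul_inv_cancel_right, trans_inv, trans_mul, sub_eq_add_neg,
    sub_eq_add_neg]

lemma trans_nsmul_mem {M : Subgroup (Perm (Vertex p))} {u v : ZMod p} (h : trans u v ∈ M)
    (n : ℕ) : trans ((n : ZMod p) * u) ((n : ZMod p) * v) ∈ M := by
  induction n with
  | zero => simp [trans_zero]
  | succ n ih =>
    have := mul_mem ih h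
    rw [trans_mul] at this
    convert this using 2 <;> push_cast <;> ring

lemma trans_mul_mem [NeZero p] {M : Subgroup (Perm (Vertex p))} {u v : ZMod p}
    (h : trans u v ∈ M) (c : ZMod p) : trans (c * u) (c * v) ∈ M := by
  simpa using trans_nsmul_mem h c.val

section Normal

variable [Fact p.Prime] (hp3 : 3 < p) {a : (ZMod p)ˣ} (ha : orderOf a = 3)
include hp3 ha

lemma exists_trans_mem {M : Subgroup (Perm (Vertex p))} (hMA : M ≤ groupA a) (hM : M ≠ ⊥)
    (hN : ∀ t ∈ transGroup p, ∀ m ∈ M, t * m * t⁻¹ ∈ M) :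
    ∃ u v, (u ≠ 0 ∨ v ≠ 0) ∧ trans u v ∈ M := by
  obtain ⟨⟨g, hg⟩, hg1⟩ := M.ne_bot_iff_exists_ne_one.1 hM
  have hg1 : g ≠ 1 := fun h => hg1 (Subtype.ext h)
  obtain ⟨u, v, i, hi, j, hj, k, hk, rfl⟩ := exists_eq_of_mem_groupA hp3 ha (hMA hg)
  interval_cases j <;> interval_cases k
  · rcases eq_or_ne i 0 with rfl | hi0
    · simp only [pow_zero, mul_one] at hg hg1
      refine ⟨u, v, ?_, hg⟩
      by_contra! h
      exact hg1 (by rw [h.1, h.2, trans_zero])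
    · refine ⟨_, _, Or.inl ?_, trans_sub_mem hg hN (x := 1) (y := 0)
        (x' := (a : ZMod p) ^ i) (y' := 0) (Equiv.ext fun z => ?_)⟩
      · exact sub_ne_zero.2 fun h => hi0 ((val_pow_eq_one_iff ha hi).1 h)
      · simp [tau_pow_apply, mul_add, add_right_comm]
  · refine ⟨_, _, Or.inl ?_, trans_sub_mem hg hN (x := 1) (y := 0)
      (x' := -(a : ZMod p) ^ i) (y' := 0) (Equiv.ext fun z => ?_)⟩
    · exact sub_ne_zero.2 fun h => val_pow_ne_neg_one ha hp3 i (by rw [← h, neg_neg])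
    · simp [tau_pow_apply, mul_add]; ring
  · refine ⟨_, _, Or.inl ?_, trans_sub_mem hg hN (x := 1) (y := 0)
      (x' := 0) (y' := ((a : ZMod p) ^ i) ^ 2) (Equiv.ext fun z => ?_)⟩
    · simp
    · simp [tau_pow_apply, mul_add, add_right_comm]
  · refine ⟨_, _, Or.inl ?_, trans_sub_mem hg hN (x := 1) (y := 0)
      (x' := 0) (y' := -((a : ZMod p) ^ i) ^ 2) (Equiv.ext fun z => ?_)⟩
    · simp
    · simp [tau_pow_apply, mul_add]; ring

/-- A nontrivial subgroup of `A` that is normalised by the translations, by `τ`, and by an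
element interchanging the two eigenspaces of `τ` contains all translations. -/
lemma transGroup_le_of_normalized {M : Subgroup (Perm (Vertex p))} (hMA : M ≤ groupA a)
    (hM : M ≠ ⊥) (hN : ∀ t ∈ transGroup p, ∀ m ∈ M, t * m * t⁻¹ ∈ M)
    (hτ : ∀ m ∈ M, tau a * m * (tau a)⁻¹ ∈ M) {s : Perm (Vertex p)} {e : ZMod p} (he : e ≠ 0)
    (hs : ∀ u v, s * trans u v * s⁻¹ = trans (e * v) (e * u))
    (hsM : ∀ m ∈ M, s * m * s⁻¹ ∈ M) : transGroup p ≤ M := by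
  obtain ⟨u, v, huv, hmem⟩ := exists_trans_mem hp3 ha hMA hM hN
  have hswap : ∀ {u v}, trans u v ∈ M → trans (e * v) (e * u) ∈ M := fun {u v} h => by
    rw [← hs]; exact hsM _ h
  obtain ⟨u, v, hu, hmem⟩ : ∃ u v, u ≠ 0 ∧ trans u v ∈ M := by
    rcases huv with h | h
    · exact ⟨u, v, h, hmem⟩
    · exact ⟨_, _, mul_ne_zero he h, hswap hmem⟩
  have h1 := hτ _ hmem
  rw [tau_conj_trans] at h1
  have h2 := mul_mem h1 (trans_mul_mem hmem (-(a : ZMod p) ^ 2))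
  rw [trans_mul, neg_mul (_ ^ 2) v, add_neg_cancel] at h2
  have hc : (a : ZMod p) * u + -(a : ZMod p) ^ 2 * u ≠ 0 := by
    have : (a : ZMod p) * u + -(a : ZMod p) ^ 2 * u = a * u * (1 - a) := by ring
    rw [this]
    exact mul_ne_zero (mul_ne_zero a.ne_zero hu) (sub_ne_zero.2 (val_ne_one ha).symm)
  set c := (a : ZMod p) * u + -(a : ZMod p) ^ 2 * u
  have h3 : ∀ x, trans x 0 ∈ M := fun x => by
    convert trans_mul_mem h2 (x * c⁻¹) using 2
    · field_simp
    · simp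
  rintro _ ⟨x, y, rfl⟩
  have h4 := mul_mem (h3 x) (hswap (h3 (e⁻¹ * y)))
  rw [trans_mul] at h4
  convert h4 using 2
  · simp
  · field_simp; simp

/-! ### Biquasiprimitivity -/

omit hp3 ha in
lemma orbitRel_card_le_two {G : Type*} [Group G] [MulAction G (Vertex p)]
    (h : ∀ x y : ZMod p, ∃ g : G, ∀ z : Vertex p, g • z = trans x y z) :
    ENat.card (MulAction.orbitRel.Quotient G (Vertex p)) ≤ 2 := by
  have hsurj : Function.Surjective fun ε : ZMod 2 =>
      (Quotient.mk'' (0, 0, ε) : MulAction.orbitRel.Quotient G (Vertex p)) := by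
    intro q
    induction q using Quotient.inductionOn' with
    | h z =>
      obtain ⟨g, hg⟩ := h (-z.1) (-z.2.1)
      refine ⟨z.2.2, Quotient.sound' ?_⟩
      exact ⟨g, by simp [hg]⟩
  have := Finite.of_surjective _ hsurj
  have h1 := Nat.card_le_card_of_surjective _ hsurj
  rw [Nat.card_zmod] at h1
  rw [ENat.card_eq_coe_natCard]
  exact_mod_cast h1

/-- A vertex-transitive group between `⟨N, τ, s⟩` and `A` is biquasiprimitive. -/
lemma isBiquasiprimitive_of_le {X : Subgroup (Perm (Vertex p))} (hXA : X ≤ groupA a)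
    (hNX : transGroup p ≤ X) (hτ : tau a ∈ X) {s : Perm (Vertex p)} {e : ZMod p} (he : e ≠ 0)
    (hs : ∀ u v, s * trans u v * s⁻¹ = trans (e * v) (e * u)) (hsX : s ∈ X)
    (htrans : ∀ v w : Vertex p, ∃ g ∈ X, g v = w) : IsBiquasiprimitive X := by
  refine ⟨⟨fun v w => ?_⟩, fun hq => ?_, fun M hM hM1 => ?_⟩
  · obtain ⟨g, hg, h⟩ := htrans v w
    exact ⟨⟨g, hg⟩, h⟩
  · have hn : ((transGroup p).subgroupOf X).Normal :=
      Subgroup.normal_subgroupOf_of_le_normalizer (hXA.trans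
        (sup_le Subgroup.le_normalizer (complA_le_normalizer a)))
    have h := hq.isPretransitive_of_normal (N := (transGroup p).subgroupOf X) (fun h => by
      have h0 : ((0, 0, 0) : Vertex p) ∈ MulAction.fixedPoints ((transGroup p).subgroupOf X)
        (Vertex p) := h ▸ Set.mem_univ _
      have := congrArg Prod.fst
        (h0 ⟨⟨trans 1 0, hNX (trans_mem 1 0)⟩, (trans_mem 1 0 : trans 1 0 ∈ transGroup p)⟩)
      have h' : (0 : ZMod p) + 1 = 0 := this
      simp at h')
    obtain ⟨⟨⟨g, hgX⟩, hg⟩, h⟩ := h.exists_smul_eq ((0, 0, 0) : Vertex p) (0, 0, 1)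
    obtain ⟨u, v, rfl⟩ : g ∈ transGroup p := hg
    have h' : (0 : ZMod 2) = 1 := congrArg (fun z : Vertex p => z.2.2) h
    exact absurd h' (by decide)
  · have hconj : ∀ x ∈ X, ∀ m ∈ M.map X.subtype, x * m * x⁻¹ ∈ M.map X.subtype := by
      rintro x hx _ ⟨m, hm, rfl⟩
      exact ⟨⟨x, hx⟩ * m * ⟨x, hx⟩⁻¹, hM.conj_mem m hm ⟨x, hx⟩, rfl⟩
    have hle := transGroup_le_of_normalized hp3 ha (M := M.map X.subtype)
      ((Subgroup.map_subtype_le M).trans hXA)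
      (fun h => hM1 ((Subgroup.map_eq_bot_iff_of_injective M X.subtype_injective).1 h))
      (fun t ht => hconj t (hNX ht)) (hconj _ hτ) he hs (hconj _ hsX)
    refine orbitRel_card_le_two fun x y => ?_
    obtain ⟨m, hm, h⟩ := hle (trans_mem x y)
    exact ⟨⟨m, hm⟩, fun z => by rw [← h]; rfl⟩

/-! ### The even subgroup -/

lemma preserves_half_of_mem {g : Perm (Vertex p)} (hg : g ∈ groupA a) {v : Vertex p}
    (hv : (g v).2.2 = v.2.2) (z : Vertex p) : (g z).2.2 = z.2.2 := by
  have h2 : ∀ ε : ZMod 2, 1 - ε ≠ ε := by decide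
  obtain ⟨x, y, i, -, j, hj, k, hk, rfl⟩ := exists_eq_of_mem_groupA hp3 ha hg
  interval_cases j <;> interval_cases k <;> simp_all [tau_pow_apply]

lemma evenSubgroup_preserves_half {X : Subgroup (Perm (Vertex p))} (hXA : X ≤ groupA a)
    {g : Perm (Vertex p)} (hg : g ∈ evenSubgroup X) : ∀ z, (g z).2.2 = z.2.2 := by
  refine Subgroup.closure_induction (p := fun g _ => ∀ z : Vertex p, (g z).2.2 = z.2.2)
    ?_ ?_ ?_ ?_ hg
  · rintro g ⟨hgX, v, hv⟩
    exact preserves_half_of_mem hp3 ha (hXA hgX) (v := v) (by rw [hv])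
  · exact fun _ => rfl
  · intro g h _ _ ihg ihh z
    rw [Perm.mul_apply, ihg, ihh]
  · intro g _ ih z
    rw [← ih, ← Perm.mul_apply, mul_inv_cancel, Perm.one_apply]

omit hp3 ha in
lemma tau_mem_evenSubgroup {X : Subgroup (Perm (Vertex p))} (hτ : tau a ∈ X) :
    tau a ∈ evenSubgroup X :=
  Subgroup.subset_closure ⟨hτ, (0, 0, 0), by simp⟩

omit hp3 in
lemma transGroup_le_evenSubgroup {X : Subgroup (Perm (Vertex p))} (hNX : transGroup p ≤ X)
    (hτ : tau a ∈ X) : transGroup p ≤ evenSubgroup X := by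
  rintro _ ⟨x, y, rfl⟩
  have h1 : (1 - a : ZMod p) ≠ 0 := sub_ne_zero.2 (val_ne_one ha).symm
  have h2 : (1 - a ^ 2 : ZMod p) ≠ 0 := sub_ne_zero.2 fun h => by
    have := (val_pow_eq_one_iff ha (i := 2) (by omega)).1 h.symm
    omega
  set u := x / (1 - a : ZMod p)
  set v := y / (1 - a ^ 2 : ZMod p)
  have h3 : trans u v * tau a * (trans u v)⁻¹ ∈ evenSubgroup X :=
    Subgroup.subset_closure ⟨mul_mem (mul_mem (hNX (trans_mem u v)) hτ)
      (inv_mem (hNX (trans_mem u v))), (u, v, 0), by rw [trans_inv]; simp⟩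
  have h4 := mul_mem h3 (inv_mem (tau_mem_evenSubgroup hτ))
  have h5 : trans u v * tau a * (trans u v)⁻¹ * (tau a)⁻¹ = trans x y := by
    rw [mul_assoc, mul_assoc, ← mul_assoc (tau a), trans_inv, tau_conj_trans, trans_mul]
    congr 1
    · simp only [u]; field_simp; ring
    · simp only [v]; field_simp; ring
  rwa [h5] at h4

lemma orbit_evenSubgroup {X : Subgroup (Perm (Vertex p))} (hXA : X ≤ groupA a)
    (hNX : transGroup p ≤ X) (hτ : tau a ∈ X) (v : Vertex p) :
    MulAction.orbit (evenSubgroup X) v = half p v.2.2 := by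
  ext w
  constructor
  · rintro ⟨⟨g, hg⟩, rfl⟩
    exact evenSubgroup_preserves_half hp3 ha hXA hg v
  · intro hw
    refine ⟨⟨trans (w.1 - v.1) (w.2.1 - v.2.1),
      transGroup_le_evenSubgroup ha hNX hτ (trans_mem _ _)⟩, ?_⟩
    have hw' : w.2.2 = v.2.2 := hw
    refine Prod.ext ?_ (Prod.ext ?_ hw'.symm)
    · exact add_sub_cancel v.1 w.1
    · exact add_sub_cancel v.2.1 w.2.1

lemma mem_half_iff_of_mem_evenSubgroup {X : Subgroup (Perm (Vertex p))} (hXA : X ≤ groupA a)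
    (ε : ZMod 2) : ∀ h ∈ evenSubgroup X, ∀ x, h x ∈ half p ε ↔ x ∈ half p ε := fun h hh x => by
  rw [half, Set.mem_ofPred_eq, Set.mem_ofPred_eq, evenSubgroup_preserves_half hp3 ha hXA hh]

omit hp3 ha in
/-- The subgroup of translations along the first axis. -/
def firstAxis (p : ℕ) : Subgroup (Perm (Vertex p)) where
  carrier := {g | ∃ u : ZMod p, g = trans u 0}
  one_mem' := ⟨0, trans_zero.symm⟩
  mul_mem' := by
    rintro _ _ ⟨u, rfl⟩ ⟨u', rfl⟩
    exact ⟨u + u', by rw [trans_mul, add_zero]⟩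
  inv_mem' := by
    rintro _ ⟨u, rfl⟩
    exact ⟨-u, by rw [trans_inv, neg_zero]⟩

lemma not_isQuasiprimitiveOn_evenSubgroup_groupG (ε : ZMod 2) :
    ¬ IsQuasiprimitiveOn (evenSubgroup (groupG a)) (half p ε) := by
  intro hq
  have hconj : ∀ h ∈ evenSubgroup (groupG a), ∀ l ∈ firstAxis p, h * l * h⁻¹ ∈ firstAxis p := by
    rintro h hh _ ⟨x, rfl⟩
    have h0 := evenSubgroup_preserves_half hp3 ha (groupG_le_groupA a) hh (0, 0, 0)
    obtain ⟨u, v, i, -, j, hj, rfl⟩ := exists_eq_of_mem_groupG hp3 ha (evenSubgroup_le _ hh)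
    interval_cases j
    · refine ⟨(a : ZMod p) ^ i * x, ?_⟩
      rw [mul_inv_eq_iff_eq_mul]
      refine Equiv.ext fun z => ?_
      simp [tau_pow_apply, mul_add, add_right_comm]
    · simp [tau_pow_apply] at h0
  have hn := normal_inducedPermGroup_subgroupOf (Δ := half p ε) hconj
  have ht := transGroup_le_evenSubgroup ha (transGroup_le_groupG a) (tau_mem_groupG a)
  have hΔ : ∀ x : Vertex p, trans 1 0 x ∈ half p ε ↔ x ∈ half p ε := fun x => Iff.rfl
  have hmem : ∀ {L : Subgroup (Perm (Vertex p))}, trans 1 0 ∈ L →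
      (trans 1 0).subtypePerm hΔ ∈ inducedPermGroup L (half p ε) := fun hL =>
    ⟨_, hL, fun _ => rfl⟩
  have h := hq.isPretransitive_of_normal (N := (inducedPermGroup (firstAxis p) _).subgroupOf _)
    (fun h => by
      have h0 : (⟨(0, 0, ε), rfl⟩ : half p ε) ∈ MulAction.fixedPoints
        ((inducedPermGroup (firstAxis p) (half p ε)).subgroupOf
          (inducedPermGroup (evenSubgroup (groupG a)) (half p ε))) (half p ε) :=
        h ▸ Set.mem_univ _
      have := congrArg (fun z => z.1.1) (h0 ⟨⟨_, hmem (ht (trans_mem 1 0))⟩, hmem ⟨1, rfl⟩⟩)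
      have h' : (0 : ZMod p) + 1 = 0 := this
      simp at h')
  obtain ⟨⟨⟨g, hgX⟩, hg⟩, h⟩ :=
    h.exists_smul_eq (⟨(0, 0, ε), rfl⟩ : half p ε) ⟨(0, 1, ε), rfl⟩
  obtain ⟨_, ⟨u, rfl⟩, hu⟩ : g ∈ inducedPermGroup (firstAxis p) (half p ε) := hg
  have h1 := (hu ⟨(0, 0, ε), rfl⟩).trans (congrArg Subtype.val h)
  have h2 : (0 : ZMod p) + 0 = 1 := congrArg (fun z : Vertex p => z.2.1) h1
  simp at h2

omit hp3 ha in
lemma sigma_mem_evenSubgroup_groupA : sigma p ∈ evenSubgroup (groupA a) :=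
  Subgroup.subset_closure ⟨sigma_mem_groupA a, (0, 0, 0), rfl⟩

lemma isQuasiprimitiveOn_evenSubgroup_groupA (ε : ZMod 2) :
    IsQuasiprimitiveOn (evenSubgroup (groupA a)) (half p ε) := by
  have hτ := groupG_le_groupA a (tau_mem_groupG a)
  have ht := transGroup_le_evenSubgroup ha
    ((transGroup_le_groupG a).trans (groupG_le_groupA a)) hτ
  have hΔ := mem_half_iff_of_mem_evenSubgroup hp3 ha (le_refl (groupA a)) ε
  have hmove : ∀ v w : half p ε, trans (w.1.1 - v.1.1) (w.1.2.1 - v.1.2.1) v.1 = w.1 := by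
    rintro ⟨v, hv⟩ ⟨w, hw⟩
    have hw' : v.2.2 = w.2.2 := Eq.trans hv (Eq.symm hw)
    refine Prod.ext ?_ (Prod.ext ?_ hw') <;> simp
  refine { exists_smul_eq := fun v w => ?_, isPretransitive_of_normal := fun {M} hM hfix => ?_ }
  · exact ⟨inducedHom _ _ hΔ ⟨_, ht (trans_mem _ _)⟩, Subtype.ext (hmove v w)⟩
  · have hM1 : M ≠ ⊥ := by
      rintro rfl
      exact hfix (fixedPoints_bot_eq_univ _ _)
    let E := evenSubgroup (groupA a)
    let M' := (M.comap (inducedHom E (half p ε) hΔ)).map E.subtype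
    have hconj : ∀ x ∈ E, ∀ m ∈ M', x * m * x⁻¹ ∈ M' := by
      rintro x hx _ ⟨m, hm, rfl⟩
      exact ⟨⟨x, hx⟩ * m * ⟨x, hx⟩⁻¹,
        (hM.comap (inducedHom E (half p ε) hΔ)).conj_mem m hm ⟨x, hx⟩, rfl⟩
    have hne : M' ≠ ⊥ := fun h => hM1 (by
      have h1 := (Subgroup.map_eq_bot_iff_of_injective _ E.subtype_injective).1 h
      rw [← Subgroup.map_comap_eq_self_of_surjective (inducedHom_surjective hΔ) M, h1,
        Subgroup.map_bot])
    have hle := transGroup_le_of_normalized hp3 ha (M := M')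
      ((Subgroup.map_subtype_le _).trans (evenSubgroup_le _)) hne
      (fun t h => hconj t (ht h)) (hconj _ (tau_mem_evenSubgroup hτ)) one_ne_zero
      (fun u v => by rw [sigma_conj_trans, one_mul, one_mul])
      (hconj _ sigma_mem_evenSubgroup_groupA)
    refine ⟨fun v w => ?_⟩
    obtain ⟨m, hm, h⟩ := hle (trans_mem (w.1.1 - v.1.1) (w.1.2.1 - v.1.2.1))
    refine ⟨⟨inducedHom E (half p ε) hΔ m, hm⟩, Subtype.ext ?_⟩
    rw [← hmove v w, ← h]
    rfl

end Normal

end SigmaGraph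

open SigmaGraph in
theorem proposition3p2 (p : ℕ) [Fact p.Prime] (hp : p ≡ 1 [MOD 3])
    (a : (ZMod p)ˣ) (ha : orderOf a = 3) :
    -- `G = N ⋊ ⟨τ, σν⟩ ≅ ℤ_p² ⋊ S₃`
    (IsInternalSemidirectProduct (SigmaGraph.groupG a) (SigmaGraph.transGroup p)
        (SigmaGraph.complG a) ∧
      Nonempty (SigmaGraph.transGroup p ≃* Multiplicative (ZMod p × ZMod p)) ∧
      Nonempty (SigmaGraph.complG a ≃* Equiv.Perm (Fin 3)) ∧
      ∃ φ : Equiv.Perm (Fin 3) →* MulAut (Multiplicative (ZMod p × ZMod p)),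
        Nonempty (SigmaGraph.groupG a ≃*
          SemidirectProduct (Multiplicative (ZMod p × ZMod p)) (Equiv.Perm (Fin 3)) φ)) ∧
    -- `G` is biquasiprimitive, `G⁺` is transitive but not quasiprimitive on each half
    IsBiquasiprimitive (SigmaGraph.groupG a) ∧
    (∀ v : SigmaGraph.Vertex p,
      MulAction.orbit (evenSubgroup (SigmaGraph.groupG a)) v = SigmaGraph.half p v.2.2) ∧
    (∀ ε : ZMod 2,
      ¬ IsQuasiprimitiveOn (evenSubgroup (SigmaGraph.groupG a)) (SigmaGraph.half p ε)) ∧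
    IsArcTransitive (SigmaGraph.graph a) (SigmaGraph.groupG a) 1 ∧
    ¬ IsArcTransitive (SigmaGraph.graph a) (SigmaGraph.groupG a) 2 ∧
    -- the full automorphism group is `A = N ⋊ ⟨τ, σ, ν⟩ ≅ ℤ_p² ⋊ (S₃ × ℤ_2)`
    graphAut (SigmaGraph.graph a) = SigmaGraph.groupA a ∧
    (IsInternalSemidirectProduct (SigmaGraph.groupA a) (SigmaGraph.transGroup p)
        (SigmaGraph.complA a) ∧
      Nonempty (SigmaGraph.complA a ≃* Equiv.Perm (Fin 3) × Multiplicative (ZMod 2)) ∧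
      ∃ φ : Equiv.Perm (Fin 3) × Multiplicative (ZMod 2) →*
          MulAut (Multiplicative (ZMod p × ZMod p)),
        Nonempty (SigmaGraph.groupA a ≃*
          SemidirectProduct (Multiplicative (ZMod p × ZMod p))
            (Equiv.Perm (Fin 3) × Multiplicative (ZMod 2)) φ)) ∧
    -- `Σ` is `(A,2)`-arc transitive, `A` is biquasiprimitive, `A⁺` is quasiprimitive on each half
    IsArcTransitive (SigmaGraph.graph a) (SigmaGraph.groupA a) 2 ∧
    IsBiquasiprimitive (SigmaGraph.groupA a) ∧
    (∀ v : SigmaGraph.Vertex p,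
      MulAction.orbit (evenSubgroup (SigmaGraph.groupA a)) v = SigmaGraph.half p v.2.2) ∧
    (∀ ε : ZMod 2,
      IsQuasiprimitiveOn (evenSubgroup (SigmaGraph.groupA a)) (SigmaGraph.half p ε)) := by
  have hp3 := three_lt_prime hp
  have hGA := groupG_le_groupA a
  have hNG := transGroup_le_groupG a
  have hτ := tau_mem_groupG a
  have hG := isInternalSemidirectProduct_of_le_complA (complG_le_complA a)
  have hA := isInternalSemidirectProduct_of_le_complA (le_refl (complA a))
  refine ⟨⟨hG, ⟨transEquiv p⟩, ⟨complGEquiv hp3 ha⟩,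
      hG.exists_mulEquiv (transEquiv p) (complGEquiv hp3 ha)⟩, ?_,
    orbit_evenSubgroup hp3 ha hGA hNG hτ, not_isQuasiprimitiveOn_evenSubgroup_groupG hp3 ha,
    isArcTransitive_groupG_one ha hp3, not_isArcTransitive_groupG_two ha hp3,
    graphAut_eq_groupA ha hp3, ⟨hA, ⟨complAEquiv hp3 ha⟩,
      hA.exists_mulEquiv (transEquiv p) (complAEquiv hp3 ha)⟩,
    isArcTransitive_groupA_two ha hp3, ?_,
    orbit_evenSubgroup hp3 ha le_rfl (hNG.trans hGA) (hGA hτ),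
    isQuasiprimitiveOn_evenSubgroup_groupA hp3 ha⟩
  · refine isBiquasiprimitive_of_le hp3 ha hGA hNG hτ (e := -1) (neg_ne_zero.2 one_ne_zero)
      (fun u v => ?_) (sigma_mul_nu_mem_groupG a) fun v w => ?_
    · have h : sigma p * nu p * trans u v * (sigma p * nu p)⁻¹ =
          sigma p * (nu p * trans u v * (nu p)⁻¹) * (sigma p)⁻¹ := by group
      rw [h, nu_conj_trans, sigma_conj_trans, neg_one_mul, neg_one_mul]
    · obtain ⟨g, hg, h, -⟩ := exists_mem_groupG_map ha v w 0 0
      exact ⟨g, hg, h⟩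
  · refine isBiquasiprimitive_of_le hp3 ha le_rfl (hNG.trans hGA) (hGA hτ) (e := 1) one_ne_zero
      (fun u v => by rw [sigma_conj_trans, one_mul, one_mul]) (sigma_mem_groupA a) fun v w => ?_
    obtain ⟨g, hg, h, -⟩ := exists_mem_groupA_map ha 1 v w
    exact ⟨g, hg, h⟩
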